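/- **Gibbs-preserving quantum thermo-majorization.** Let $\gamma,\rho$ be $d\times d$ density matrices and let $\gamma',\rho'$ be $d'\times d'$ density matrices (a density matrix is a positive semidefinite complex matrix of trace one), where $\gamma$ and $\gamma'$ are the Gibbs states of the input and of the output system. For a matrix $\Omega$ on $\mathbb{C}^{a}\otimes\mathbb{C}^{b}$ (systems $A$ and $B$) let $$H_{\min}(A|B)_\Omega=-\log_2\min\{\operatorname{Tr}\tau : \tau\ge 0,\ I_a\otimes\tau\ge\Omega\},$$ where $\tau$ ranges over the positive semidefinite $b\times b$ matrices and $\ge$ is the Loewner order. Then the following are equivalent. 1. $\rho$ can be converted to $\rho'$ by a Gibbs-preserving operation: there is a completely positive trace-preserving linear map $\mathcal{E}$ from the $d\times d$ to the $d'\times d'$ complex matrices with $\mathcal{E}(\gamma)=\gamma'$ and $\mathcal{E}(\rho)=\rho'$. 2. For all $d'\times d'$ density matrices $\omega_0,\omega_1$, $$H_{\min}(A|B)_{\frac12(\omega_0\otimes\rho+\omega_1\otimes\gamma)}\le H_{\min}(A|B)_{\frac12(\omega_0\otimes\rho'+\omega_1\otimes\gamma')}.$$ -/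

import Mathlib

open scoped Kronecker MatrixOrder ComplexOrder Matrix.Norms.L2Operator CStarAlgebra

/-- The `d × d` density matrices: positive semidefinite complex matrices of trace one. -/
def densityMatrices (d : ℕ) : Set (Matrix (Fin d) (Fin d) ℂ) :=
  {ρ | ρ.PosSemidef ∧ ρ.trace = 1}

/-- A quantum channel from `d × d` to `d' × d'` matrices: a completely positive complex-linear map
(Mathlib's `→CP`, for the C⋆-algebras of complex matrices with the Loewner order) that preserves
the trace. -/
structure QuantumChannel (d d' : ℕ) where
  toCP : Matrix (Fin d) (Fin d) ℂ →CP Matrix (Fin d') (Fin d') ℂ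
  trace_preserving : ∀ X, (toCP X).trace = X.trace

/-- `ρ` can be converted to `ρ'` by a Gibbs-preserving operation, i.e. by a quantum channel that
maps the input Gibbs state `γ` to the output Gibbs state `γ'`. -/
def GibbsConvertible {d d' : ℕ} (γ : Matrix (Fin d) (Fin d) ℂ) (γ' : Matrix (Fin d') (Fin d') ℂ)
    (ρ : Matrix (Fin d) (Fin d) ℂ) (ρ' : Matrix (Fin d') (Fin d') ℂ) : Prop :=
  ∃ E : QuantumChannel d d', E.toCP γ = γ' ∧ E.toCP ρ = ρ'

/-- The conditional min-entropy
`H_min(A|B)_Ω = - log₂ min {Tr τ | τ ≥ 0, I_A ⊗ τ ≥ Ω}` of a matrix `Ω` on `A ⊗ B`, where `A` has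
dimension `a` and `B` has dimension `b`. The order on matrices is the Loewner order (`X ≤ Y` iff
`Y - X` is positive semidefinite); the trace of a positive semidefinite `τ` is real. -/
noncomputable def condMinEntropy {a b : ℕ}
    (Ω : Matrix (Fin a × Fin b) (Fin a × Fin b) ℂ) : ℝ :=
  -Real.logb 2 (sInf {t : ℝ | ∃ τ : Matrix (Fin b) (Fin b) ℂ,
    0 ≤ τ ∧ Ω ≤ (1 : Matrix (Fin a) (Fin a) ℂ) ⊗ₖ τ ∧ t = τ.trace.re})

/-- The bipartite matrix `½ (ω₀ ⊗ ρ + ω₁ ⊗ γ)`. -/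
noncomputable def mixedState {a b : ℕ} (ω₀ ω₁ : Matrix (Fin a) (Fin a) ℂ)
    (ρ γ : Matrix (Fin b) (Fin b) ℂ) : Matrix (Fin a × Fin b) (Fin a × Fin b) ℂ :=
  (1 / 2 : ℂ) • (ω₀ ⊗ₖ ρ + ω₁ ⊗ₖ γ)

/-!
Let `f Ω = min {Tr τ | τ ≥ 0, Ω ≤ 1 ⊗ τ}`, so that `H_min = -log₂ f`; for a state `Ω` this minimum is
positive, and the entropy inequality says `f Ω' ≤ f Ω` for the two mixtures `Ω` (of `ρ` and `γ`) and
`Ω'` (of `ρ'` and `γ'`), by `condMinEntropy_le_iff`.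

If a channel `E` performs the conversion and `τ` is feasible for `Ω`, then `E τ` is feasible for `Ω'`
and has the same trace, because `id ⊗ E` is positive (`minEntropyValues_subset`).

For the converse, identify channels with their Choi matrices: positive semidefinite `J` whose partial
trace over the output is `1`. The triples (partial trace of `J`, image of `ρ`, image of `γ`) with
`J ≥ 0` form a convex cone, closed since the first component controls the trace of `J`. If no channel
performs the conversion, then `(1, ρ', γ')` lies outside this cone, and a separating hyperplane gives
Hermitian matrices with `X ⊗ ρ + Y ⊗ γ ≤ 1 ⊗ τ` and `Tr τ < ∑ X i j ρ' i j + ∑ Y i j γ' i j`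
(`exists_choi_or_exists_witness`). Shifting by multiples of the identity and rescaling turns `X` and
`Y` into density matrices `ω₀` and `ω₁` (`exists_densityMatrices_of_witness`). With `τ` adjusted
accordingly, the first inequality bounds `f Ω` above by `Tr τ / 2`, while testing with the maximally
entangled vector bounds `f Ω'` below by half of the right-hand side of the second
(`overlap_le_of_mem_minEntropyValues`), so `f Ω < f Ω'`.
-/

namespace Matrix

/-! ### Positivity of block matrices -/

variable {m n κ : Type*} [Fintype m] [Fintype n] [Fintype κ]

/-- A positive element of the C⋆-algebra of `κ × κ` matrices over `n × n` matrices is a positive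
semidefinite matrix once its entries are indexed by `κ × n`. -/
theorem posSemidef_flatten_of_nonneg [DecidableEq n] {M : CStarMatrix κ κ (Matrix n n ℂ)}
    (hM : 0 ≤ M) : (of fun p q : κ × n => M p.1 q.1 p.2 q.2).PosSemidef := by
  rw [StarOrderedRing.nonneg_iff] at hM
  induction hM using AddSubmonoid.closure_induction with
  | mem x hx =>
    obtain ⟨B, rfl⟩ := hx
    convert posSemidef_conjTranspose_mul_self (of fun p q : κ × n => B p.1 q.1 p.2 q.2) using 1
    ext p q
    simp [CStarMatrix.mul_apply, Matrix.mul_apply, Matrix.sum_apply, Fintype.sum_prod_type,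
      CStarMatrix.star_apply, Matrix.star_apply]
  | zero => exact PosSemidef.zero
  | add x y _ _ hx hy => exact hx.add hy

theorem nonneg_of_posSemidef_flatten [DecidableEq n] {M : CStarMatrix κ κ (Matrix n n ℂ)}
    (hM : (of fun p q : κ × n => M p.1 q.1 p.2 q.2).PosSemidef) : 0 ≤ M := by
  classical
  obtain ⟨B, hB⟩ := CStarAlgebra.nonneg_iff_eq_star_mul_self.mp hM.nonneg
  convert star_mul_self_nonneg
    (CStarMatrix.ofMatrix (of fun k l => of fun i j => B (k, i) (l, j)) :
      CStarMatrix κ κ (Matrix n n ℂ)) using 1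
  ext k l i j
  have := congrFun₂ hB (k, i) (l, j)
  simp only [of_apply] at this
  rw [this]
  simp [CStarMatrix.mul_apply, Matrix.mul_apply, Matrix.sum_apply, Fintype.sum_prod_type,
    CStarMatrix.star_apply, Matrix.star_apply]

/-- Summing every block of a positive semidefinite block matrix is a compression by the matrix
`x ↦ ∑ i, e (x, i)`, so positivity is kept. -/
theorem PosSemidef.sum_blocks [DecidableEq κ] {P : Matrix (κ × n) (κ × n) ℂ} (hP : P.PosSemidef) :
    (of fun x y => ∑ i, ∑ j, P (x, i) (y, j)).PosSemidef := by
  convert hP.conjTranspose_mul_mul_same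
    (of fun p x => if p.1 = x then 1 else 0 : Matrix (κ × n) κ ℂ) using 1
  ext x y
  simp only [Matrix.mul_apply, Fintype.sum_prod_type, conjTranspose_apply, of_apply]
  simp [apply_ite]
  rw [Finset.sum_comm]

/-! ### The map with a given Choi matrix -/

/-- The linear map with Choi matrix `J`. The output index comes first in `m × n`, and no transpose
is taken: `choiMap J T x y = ∑ i j, J (x, i) (y, j) * T i j`. -/
def choiMap (J : Matrix (m × n) (m × n) ℂ) : Matrix n n ℂ →ₗ[ℂ] Matrix m m ℂ where
  toFun T := of fun x y => ∑ i, ∑ j, J (x, i) (y, j) * T i j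
  map_add' S T := by ext; simp [mul_add, Finset.sum_add_distrib]
  map_smul' c T := by ext; simp [Finset.mul_sum, mul_left_comm]

/-- The partial trace over the first tensor factor. -/
def partialTrace (J : Matrix (m × n) (m × n) ℂ) : Matrix n n ℂ :=
  of fun i j => ∑ x, J (x, i) (x, j)

theorem trace_choiMap [DecidableEq n] {J : Matrix (m × n) (m × n) ℂ} (hJ : partialTrace J = 1)
    (T : Matrix n n ℂ) : (choiMap J T).trace = T.trace := by
  have h : ∀ i j, ∑ x, J (x, i) (x, j) = if i = j then 1 else 0 := fun i j => by
    simpa [partialTrace, one_apply] using congrFun₂ hJ i j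
  simp only [trace, choiMap, diag_apply, LinearMap.coe_mk, AddHom.coe_mk, of_apply]
  rw [Finset.sum_comm]
  refine Finset.sum_congr rfl fun i _ => ?_
  rw [Finset.sum_comm]
  simp [← Finset.sum_mul, h]

/-- Complete positivity: applying `choiMap J` to every block of `M` amounts to summing the blocks
of a principal submatrix of `J ⊗ M`. -/
theorem choiMap_map_nonneg [DecidableEq m] [DecidableEq n] [DecidableEq κ]
    {J : Matrix (m × n) (m × n) ℂ} (hJ : J.PosSemidef) {M : CStarMatrix κ κ (Matrix n n ℂ)}
    (hM : 0 ≤ M) : 0 ≤ M.map (choiMap J) := by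
  apply nonneg_of_posSemidef_flatten
  have h := (hJ.kronecker (posSemidef_flatten_of_nonneg hM)).submatrix
    (fun p : (κ × m) × n => ((p.1.2, p.2), (p.1.1, p.2)))
  convert h.sum_blocks using 1
  ext p q
  simp [choiMap, kroneckerMap_apply]

/-! ### Compactness of sets of positive semidefinite matrices -/

theorem PosSemidef.norm_apply_le {J : Matrix n n ℂ} (hJ : J.PosSemidef) (i j : n) :
    ‖J i j‖ ≤ J.trace.re := by
  classical
  obtain ⟨B, rfl⟩ := CStarAlgebra.nonneg_iff_eq_star_mul_self.mp hJ.nonneg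
  have hd : ∀ i, ((star B * B) i i).re = ∑ k, ‖B k i‖ ^ 2 := fun i => by
    simp [mul_apply, star_apply, ← Complex.normSq_eq_norm_sq, Complex.normSq_apply]
  have hle : ∀ i, ∑ k, ‖B k i‖ ^ 2 ≤ (star B * B).trace.re := fun i => by
    simp only [trace, diag_apply, Complex.re_sum, hd]
    exact Finset.single_le_sum (f := fun i => ∑ k, ‖B k i‖ ^ 2) (fun _ _ => by positivity)
      (Finset.mem_univ i)
  have : ‖(star B * B) i j‖ ≤ ∑ k, (‖B k i‖ ^ 2 + ‖B k j‖ ^ 2) / 2 := by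
    rw [mul_apply]
    refine norm_sum_le_of_le _ fun k _ => ?_
    rw [norm_mul, star_apply, norm_star]
    nlinarith [sq_nonneg (‖B k i‖ - ‖B k j‖)]
  rw [← Finset.sum_div, Finset.sum_add_distrib] at this
  linarith [hle i, hle j]

theorem isClosed_setOf_posSemidef : IsClosed {J : Matrix n n ℂ | J.PosSemidef} := by
  classical
  have : {J : Matrix n n ℂ | J.PosSemidef} = Set.Ici 0 := by ext; simp [nonneg_iff_posSemidef]
  rw [this]
  exact isClosed_Ici

theorem isCompact_setOf_posSemidef (R : ℝ) :
    IsCompact {J : Matrix n n ℂ | J.PosSemidef ∧ J.trace.re ≤ R} := by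
  have hc : IsCompact (Set.univ.pi fun _ => Set.univ.pi fun _ => Metric.closedBall (0 : ℂ) R :
      Set (Matrix n n ℂ)) :=
    isCompact_univ_pi fun _ => isCompact_univ_pi fun _ => isCompact_closedBall _ _
  refine hc.of_isClosed_subset (isClosed_setOf_posSemidef.inter
    (isClosed_le (Complex.continuous_re.comp continuous_id.matrix_trace) continuous_const)) ?_
  rintro J ⟨hJ, hR⟩ i _ j _
  simpa using (hJ.norm_apply_le i j).trans hR

/-! ### The dual of a channel feasibility problem -/

/-- On Hermitian matrices every real-linear functional is the pairing `R ↦ ∑ i j, G i j * R i j`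
with a Hermitian matrix `G`. -/
theorem exists_isHermitian_forall_eq_re_sum [DecidableEq n] (g : Matrix n n ℂ →ₗ[ℝ] ℝ) :
    ∃ G : Matrix n n ℂ, G.IsHermitian ∧
      ∀ R : Matrix n n ℂ, R.IsHermitian → g R = (∑ i, ∑ j, G i j * R i j).re := by
  -- `F` represents `g` on all matrices; its Hermitian part suffices on Hermitian ones.
  set F : Matrix n n ℂ := of fun i j =>
    (g (single i j 1) : ℂ) - g (single i j Complex.I) * Complex.I
  have hF : ∀ R, g R = (∑ i, ∑ j, F i j * R i j).re := fun R => by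
    conv_lhs => rw [matrix_eq_sum_single R]
    simp only [map_sum, Complex.re_sum]
    refine Finset.sum_congr rfl fun i _ => Finset.sum_congr rfl fun j _ => ?_
    have : single i j (R i j) =
        (R i j).re • single i j (1 : ℂ) + (R i j).im • single i j Complex.I := by
      rw [smul_single, smul_single, ← single_add]
      congr 1
      simp [Complex.re_add_im]
    rw [this, map_add, map_smul, map_smul]
    simp [F]
    ring
  refine ⟨(1 / 2 : ℂ) • (F + Fᴴ), ?_, fun R hR => ?_⟩
  · simp [IsHermitian, conjTranspose_smul, add_comm]
  · have : ∑ i, ∑ j, Fᴴ i j * R i j = star (∑ i, ∑ j, F i j * R i j) := by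
      rw [Finset.sum_comm]
      simp only [star_sum, star_mul', conjTranspose_apply]
      refine Finset.sum_congr rfl fun i _ => Finset.sum_congr rfl fun j _ => ?_
      rw [← hR.apply j i]
    simp only [smul_apply, add_apply, smul_eq_mul, mul_assoc, ← Finset.mul_sum, add_mul,
      Finset.sum_add_distrib, this]
    rw [hF R]
    simp
    ring

/-- The values that a Choi matrix `J` has to meet: its partial trace, which is `1` exactly when
`choiMap J` preserves the trace, and the images of `ρ` and `γ` under `choiMap J`. -/
def choiData (ρ γ : Matrix n n ℂ) :
    Matrix (m × n) (m × n) ℂ →ₗ[ℝ] Matrix n n ℂ × Matrix m m ℂ × Matrix m m ℂ where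
  toFun J := (partialTrace J, choiMap J ρ, choiMap J γ)
  map_add' J K := by
    simp only [Prod.mk_add_mk, Prod.mk.injEq]
    refine ⟨?_, ?_, ?_⟩ <;> ext <;>
      simp [partialTrace, choiMap, add_mul, Finset.sum_add_distrib]
  map_smul' c J := by
    simp only [Prod.smul_mk, Prod.mk.injEq]
    refine ⟨?_, ?_, ?_⟩ <;> ext <;>
      simp [partialTrace, choiMap, Finset.mul_sum, mul_assoc]

theorem PosSemidef.partialTrace {m n : Type*} [Fintype m]
    {J : Matrix (m × n) (m × n) ℂ} (hJ : J.PosSemidef) : J.partialTrace.PosSemidef := by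
  have : J.partialTrace = ∑ x, J.submatrix (fun i => (x, i)) (fun i => (x, i)) := by
    ext; simp [Matrix.partialTrace, Matrix.sum_apply]
  rw [this]
  exact posSemidef_sum _ fun x _ => hJ.submatrix _

theorem PosSemidef.isHermitian_choiMap {m n : Type*} [Fintype n]
    {J : Matrix (m × n) (m × n) ℂ} (hJ : J.PosSemidef)
    {T : Matrix n n ℂ} (hT : T.IsHermitian) : (choiMap J T).IsHermitian := by
  ext x y
  simp only [choiMap, LinearMap.coe_mk, AddHom.coe_mk, conjTranspose_apply, of_apply, star_sum,
    star_mul', hJ.isHermitian.apply, hT.apply]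
  exact Finset.sum_comm

theorem trace_partialTrace (J : Matrix (m × n) (m × n) ℂ) :
    (partialTrace J).trace = J.trace := by
  simp only [trace, diag_apply, partialTrace, of_apply, Fintype.sum_prod_type]
  exact Finset.sum_comm

theorem sum_kronecker_mul (X : Matrix m m ℂ) (T : Matrix n n ℂ) (J : Matrix (m × n) (m × n) ℂ) :
    ∑ p, ∑ q, (X ⊗ₖ T) p q * J p q = ∑ a, ∑ b, X a b * choiMap J T a b := by
  simp only [Fintype.sum_prod_type, kroneckerMap_apply, choiMap, LinearMap.coe_mk, AddHom.coe_mk,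
    of_apply, Finset.mul_sum]
  refine Finset.sum_congr rfl fun a _ => ?_
  rw [Finset.sum_comm]
  exact Finset.sum_congr rfl fun b _ => Finset.sum_congr rfl fun i _ =>
    Finset.sum_congr rfl fun j _ => by ring

theorem sum_one_kronecker_mul [DecidableEq m] (G : Matrix n n ℂ) (J : Matrix (m × n) (m × n) ℂ) :
    ∑ p, ∑ q, ((1 : Matrix m m ℂ) ⊗ₖ G) p q * J p q = ∑ i, ∑ j, G i j * partialTrace J i j := by
  simp only [Fintype.sum_prod_type, kroneckerMap_apply, partialTrace, of_apply, Finset.mul_sum,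
    one_apply]
  rw [Finset.sum_comm]
  refine Finset.sum_congr rfl fun i _ => ?_
  rw [Finset.sum_comm]
  simp only [ite_mul, one_mul, zero_mul]
  simp
  rw [Finset.sum_comm]

/-- The trace of `J` can be read off `choiData ρ γ J`, so a convergent sequence of values comes from
Choi matrices in a compact set. -/
theorem isClosed_choiData_image [DecidableEq m] [DecidableEq n] (ρ γ : Matrix n n ℂ) :
    IsClosed (choiData (m := m) ρ γ '' {J | J.PosSemidef}) := by
  refine IsSeqClosed.isClosed fun y z hy hyz => ?_
  choose J hJ hJy using hy
  have htr : Filter.Tendsto (fun k => (J k).trace.re) Filter.atTop (nhds z.1.trace.re) := by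
    have hc : Continuous fun w : Matrix n n ℂ × Matrix m m ℂ × Matrix m m ℂ => w.1.trace.re :=
      Complex.continuous_re.comp continuous_fst.matrix_trace
    refine ((hc.tendsto z).comp hyz).congr fun k => ?_
    rw [Function.comp_apply, ← hJy, ← trace_partialTrace]
    rfl
  obtain ⟨R, hR⟩ := htr.bddAbove_range
  have hclosed := ((isCompact_setOf_posSemidef (n := m × n) R).image
    (choiData ρ γ).continuous_of_finiteDimensional).isClosed
  obtain ⟨K, hK, hKz⟩ := hclosed.mem_of_tendsto hyz (Filter.Eventually.of_forall fun k =>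
    ⟨J k, ⟨hJ k, hR ⟨k, rfl⟩⟩, hJy k⟩)
  exact ⟨K, hK.1, hKz⟩

/-- Either some channel sends `ρ` to `ρ'` and `γ` to `γ'`, or there is a dual witness. The witness is
a hyperplane that separates `(1, ρ', γ')` from the closed convex cone of all values `choiData ρ γ J`
with `J` positive semidefinite. -/
theorem exists_choi_or_exists_witness [DecidableEq m] [DecidableEq n] {ρ γ : Matrix n n ℂ}
    (hρ : ρ.IsHermitian) (hγ : γ.IsHermitian) {ρ' γ' : Matrix m m ℂ} (hρ' : ρ'.IsHermitian)
    (hγ' : γ'.IsHermitian) :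
    (∃ J : Matrix (m × n) (m × n) ℂ, J.PosSemidef ∧ partialTrace J = 1 ∧ choiMap J ρ = ρ' ∧
      choiMap J γ = γ') ∨
    ∃ (τ : Matrix n n ℂ) (X Y : Matrix m m ℂ), X.IsHermitian ∧ Y.IsHermitian ∧
      X ⊗ₖ ρ + Y ⊗ₖ γ ≤ (1 : Matrix m m ℂ) ⊗ₖ τ ∧
      τ.trace.re < (∑ i, ∑ j, X i j * ρ' i j).re + (∑ i, ∑ j, Y i j * γ' i j).re := by
  rw [or_iff_not_imp_left]
  intro hno
  set C := choiData (m := m) ρ γ '' {J | J.PosSemidef}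
  have hconv : Convex ℝ C := by
    refine Convex.linear_image ?_ _
    intro J hJ K hK a b ha hb _
    exact (hJ.smul ha).add (hK.smul hb)
  have hnot : ((1 : Matrix n n ℂ), ρ', γ') ∉ C := by
    rintro ⟨J, hJ, h⟩
    exact hno ⟨J, hJ, congrArg Prod.fst h, congrArg (fun w => w.2.1) h, congrArg (fun w => w.2.2) h⟩
  obtain ⟨f, u, hfu, hu⟩ := geometric_hahn_banach_closed_point hconv
    (isClosed_choiData_image ρ γ) hnot
  have hu0 : 0 < u := by
    simpa using hfu 0 ⟨0, PosSemidef.zero, map_zero _⟩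
  -- `f` is bounded above on a cone, so it is nonpositive there.
  have hf0 : ∀ J : Matrix (m × n) (m × n) ℂ, J.PosSemidef → f (choiData ρ γ J) ≤ 0 := by
    intro J hJ
    by_contra! hpos
    have := hfu _ ⟨(u / f (choiData ρ γ J)) • J, hJ.smul (by positivity), map_smul _ _ _⟩
    rw [map_smul, smul_eq_mul, div_mul_cancel₀ _ hpos.ne'] at this
    exact lt_irrefl _ this
  obtain ⟨G, hG, hGf⟩ := exists_isHermitian_forall_eq_re_sum
    (f.toLinearMap ∘ₗ LinearMap.inl ℝ _ _)
  obtain ⟨X, hX, hXf⟩ := exists_isHermitian_forall_eq_re_sum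
    (f.toLinearMap ∘ₗ LinearMap.inr ℝ _ _ ∘ₗ LinearMap.inl ℝ _ _)
  obtain ⟨Y, hY, hYf⟩ := exists_isHermitian_forall_eq_re_sum
    (f.toLinearMap ∘ₗ LinearMap.inr ℝ _ _ ∘ₗ LinearMap.inr ℝ _ _)
  have hfsplit : ∀ (R : Matrix n n ℂ) (S T : Matrix m m ℂ), R.IsHermitian → S.IsHermitian →
      T.IsHermitian → f (R, S, T) = (∑ i, ∑ j, G i j * R i j).re +
        (∑ i, ∑ j, X i j * S i j).re + (∑ i, ∑ j, Y i j * T i j).re := by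
    intro R S T hR hS hT
    rw [← hGf R hR, ← hXf S hS, ← hYf T hT]
    simp [← map_add]
  refine ⟨-G, X, Y, hX, hY, ?_, ?_⟩
  · rw [le_iff]
    have hH : ((1 : Matrix m m ℂ) ⊗ₖ (-G) - (X ⊗ₖ ρ + Y ⊗ₖ γ)).IsHermitian := by
      simp [IsHermitian, conjTranspose_kronecker, hX.eq, hY.eq, hG.eq, hρ.eq, hγ.eq]
    refine PosSemidef.of_dotProduct_mulVec_nonneg hH fun v => ?_
    -- Rank-one Choi matrices test positivity of a matrix.
    have hJ := posSemidef_vecMulVec_star_self v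
    have h := hf0 _ hJ
    have h2 := hfsplit _ _ _ hJ.partialTrace.isHermitian (hJ.isHermitian_choiMap hρ)
      (hJ.isHermitian_choiMap hγ)
    rw [Complex.nonneg_iff]
    refine ⟨?_, (hH.im_star_dotProduct_mulVec_self v).symm⟩
    have hsum : star v ⬝ᵥ ((1 : Matrix m m ℂ) ⊗ₖ (-G) - (X ⊗ₖ ρ + Y ⊗ₖ γ)) *ᵥ v =
        -(∑ p, ∑ q, ((1 : Matrix m m ℂ) ⊗ₖ G) p q * vecMulVec (star v) v p q +
          ∑ p, ∑ q, (X ⊗ₖ ρ) p q * vecMulVec (star v) v p q +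
          ∑ p, ∑ q, (Y ⊗ₖ γ) p q * vecMulVec (star v) v p q) := by
      simp only [← Finset.sum_add_distrib, ← Finset.sum_neg_distrib, dotProduct, mulVec,
        Finset.mul_sum, vecMulVec_apply, sub_apply, add_apply, kroneckerMap_apply, neg_apply]
      exact Finset.sum_congr rfl fun p _ => Finset.sum_congr rfl fun q _ => by ring
    rw [hsum, sum_one_kronecker_mul, sum_kronecker_mul, sum_kronecker_mul]
    have h3 := h2 ▸ h
    simp only [Complex.neg_re, Complex.add_re]
    linarith
  · have := hu0.trans hu
    rw [hfsplit _ _ _ isHermitian_one hρ' hγ'] at this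
    simp [one_apply, trace] at this ⊢
    linarith

end Matrix

/-! ### The conditional min-entropy -/

open Matrix

/-- The traces of the feasible `τ` in the definition of `condMinEntropy Ω`. -/
def minEntropyValues {a b : ℕ} (Ω : Matrix (Fin a × Fin b) (Fin a × Fin b) ℂ) : Set ℝ :=
  {t : ℝ | ∃ τ : Matrix (Fin b) (Fin b) ℂ,
    0 ≤ τ ∧ Ω ≤ (1 : Matrix (Fin a) (Fin a) ℂ) ⊗ₖ τ ∧ t = τ.trace.re}

theorem condMinEntropy_eq {a b : ℕ} (Ω : Matrix (Fin a × Fin b) (Fin a × Fin b) ℂ) :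
    condMinEntropy Ω = -Real.logb 2 (sInf (minEntropyValues Ω)) := rfl

theorem pos_of_mem_densityMatrices {d : ℕ} {ρ : Matrix (Fin d) (Fin d) ℂ}
    (hρ : ρ ∈ densityMatrices d) : 0 < d := by
  rcases Nat.eq_zero_or_pos d with rfl | h
  · -- The trace of an empty matrix is `0`, not `1`.
    simpa [Matrix.trace] using hρ.2
  · exact h

theorem mixedState_mem {a b : ℕ} {ω₀ ω₁ : Matrix (Fin a) (Fin a) ℂ}
    {ρ γ : Matrix (Fin b) (Fin b) ℂ} (h₀ : ω₀ ∈ densityMatrices a) (h₁ : ω₁ ∈ densityMatrices a)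
    (hρ : ρ ∈ densityMatrices b) (hγ : γ ∈ densityMatrices b) :
    (mixedState ω₀ ω₁ ρ γ).PosSemidef ∧ (mixedState ω₀ ω₁ ρ γ).trace = 1 := by
  refine ⟨((h₀.1.kronecker hρ.1).add (h₁.1.kronecker hγ.1)).smul ?_, ?_⟩
  · rw [Complex.nonneg_iff]; norm_num
  · simp [mixedState, trace_kronecker, h₀.2, h₁.2, hρ.2, hγ.2]
    norm_num

theorem inv_le_of_mem_minEntropyValues {a b : ℕ} (ha : 0 < a)
    {Ω : Matrix (Fin a × Fin b) (Fin a × Fin b) ℂ} (hΩ : Ω.trace = 1) {t : ℝ}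
    (ht : t ∈ minEntropyValues Ω) : (a : ℝ)⁻¹ ≤ t := by
  obtain ⟨τ, -, hle, rfl⟩ := ht
  have h := (Complex.nonneg_iff.mp (Matrix.le_iff.mp hle).trace_nonneg).1
  rw [trace_sub, trace_kronecker, hΩ, trace_one] at h
  simp at h
  rw [inv_le_iff_one_le_mul₀' (by positivity)]
  exact h

theorem bddBelow_minEntropyValues {a b : ℕ} (Ω : Matrix (Fin a × Fin b) (Fin a × Fin b) ℂ) :
    BddBelow (minEntropyValues Ω) := by
  refine ⟨0, ?_⟩
  rintro _ ⟨τ, hτ, -, rfl⟩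
  exact (Complex.nonneg_iff.mp hτ.posSemidef.trace_nonneg).1

theorem minEntropyValues_nonempty {a b : ℕ} {Ω : Matrix (Fin a × Fin b) (Fin a × Fin b) ℂ}
    (hΩ : Ω.PosSemidef) : (minEntropyValues Ω).Nonempty := by
  have h : Ω ≤ algebraMap ℝ _ ‖Ω‖ := hΩ.isHermitian.isSelfAdjoint.le_algebraMap_norm_self
  refine ⟨_, (‖Ω‖ : ℂ) • 1, (PosSemidef.one.smul (by simp)).nonneg, ?_, rfl⟩
  convert h using 1
  rw [kronecker_smul, one_kronecker_one, Algebra.algebraMap_eq_smul_one]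
  rfl

theorem sInf_minEntropyValues_pos {a b : ℕ} (ha : 0 < a)
    {Ω : Matrix (Fin a × Fin b) (Fin a × Fin b) ℂ} (hΩ : Ω.PosSemidef ∧ Ω.trace = 1) :
    0 < sInf (minEntropyValues Ω) :=
  (show (0 : ℝ) < (a : ℝ)⁻¹ by positivity).trans_le <|
    le_csInf (minEntropyValues_nonempty hΩ.1) fun _ => inv_le_of_mem_minEntropyValues ha hΩ.2

theorem condMinEntropy_le_iff {a b b' : ℕ} (ha : 0 < a)
    {Ω : Matrix (Fin a × Fin b) (Fin a × Fin b) ℂ} (hΩ : Ω.PosSemidef ∧ Ω.trace = 1)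
    {Ω' : Matrix (Fin a × Fin b') (Fin a × Fin b') ℂ} (hΩ' : Ω'.PosSemidef ∧ Ω'.trace = 1) :
    condMinEntropy Ω ≤ condMinEntropy Ω' ↔
      sInf (minEntropyValues Ω') ≤ sInf (minEntropyValues Ω) := by
  rw [condMinEntropy_eq, condMinEntropy_eq, neg_le_neg_iff]
  exact Real.logb_le_logb one_lt_two (sInf_minEntropyValues_pos ha hΩ')
    (sInf_minEntropyValues_pos ha hΩ)

/-- Applying a channel to system `B` keeps `τ` feasible and does not change its trace. -/
theorem minEntropyValues_subset {a d d' : ℕ} (E : QuantumChannel d d')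
    (ω₀ ω₁ : Matrix (Fin a) (Fin a) ℂ) (ρ γ : Matrix (Fin d) (Fin d) ℂ) :
    minEntropyValues (mixedState ω₀ ω₁ ρ γ) ⊆
      minEntropyValues (mixedState ω₀ ω₁ (E.toCP ρ) (E.toCP γ)) := by
  rintro _ ⟨τ, hτ, hle, rfl⟩
  refine ⟨E.toCP τ, ?_, ?_, by rw [E.trace_preserving]⟩
  · simpa using OrderHomClass.mono E.toCP hτ
  · set W := (1 : Matrix (Fin a) (Fin a) ℂ) ⊗ₖ τ - mixedState ω₀ ω₁ ρ γ
    have h := posSemidef_flatten_of_nonneg <| E.toCP.map_cstarMatrix_nonneg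
      (CStarMatrix.ofMatrix (of fun k l => of fun i j => W (k, i) (l, j)))
      (nonneg_of_posSemidef_flatten (Matrix.le_iff.mp hle))
    rw [Matrix.le_iff]
    refine Eq.subst (motive := Matrix.PosSemidef) ?_ h
    ext ⟨k, i⟩ ⟨l, j⟩
    have hW : (of fun i j => W (k, i) (l, j)) =
        (1 : Matrix (Fin a) (Fin a) ℂ) k l • τ - (1 / 2 : ℂ) • (ω₀ k l • ρ + ω₁ k l • γ) := by
      ext; simp [W, mixedState]
    rw [of_apply]
    change E.toCP (of fun i j => W (k, i) (l, j)) i j = _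
    rw [hW, map_sub, map_smul, map_smul, map_add, map_smul, map_smul]
    simp [mixedState]

/-- The bound comes from testing `1 ⊗ τ - Ω` against the unnormalized maximally entangled vector
`∑ i, e (i, i)`, that is, on the principal submatrix of the diagonal indices. -/
theorem overlap_le_of_mem_minEntropyValues {a : ℕ} {ω₀ ω₁ ρ γ : Matrix (Fin a) (Fin a) ℂ} {t : ℝ}
    (ht : t ∈ minEntropyValues (mixedState ω₀ ω₁ ρ γ)) :
    ((∑ i, ∑ j, ω₀ i j * ρ i j).re + (∑ i, ∑ j, ω₁ i j * γ i j).re) / 2 ≤ t := by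
  obtain ⟨τ, -, hle, rfl⟩ := ht
  have h := ((Matrix.le_iff.mp hle).submatrix fun i : Fin a => (i, i)).dotProduct_mulVec_nonneg 1
  have h2 : star 1 ⬝ᵥ (((1 : Matrix (Fin a) (Fin a) ℂ) ⊗ₖ τ - mixedState ω₀ ω₁ ρ γ).submatrix
      (fun i : Fin a => (i, i)) fun i => (i, i)) *ᵥ 1 =
      τ.trace - (1 / 2 : ℂ) * (∑ i, ∑ j, ω₀ i j * ρ i j + ∑ i, ∑ j, ω₁ i j * γ i j) := by
    simp [dotProduct, mulVec, mixedState, Finset.sum_sub_distrib, one_apply, trace,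
      ← Finset.mul_sum, Finset.sum_add_distrib, ← mul_add]
  rw [h2, Complex.nonneg_iff] at h
  have h3 := h.1
  rw [Complex.sub_re, show (1 / 2 : ℂ) = ((1 / 2 : ℝ) : ℂ) by norm_num, Complex.re_ofReal_mul,
    Complex.add_re] at h3
  linarith

/-- A dual witness can be taken to consist of density matrices. Adding `c₀` to `X`, `c₁` to `Y` and
`c₀ ρ + c₁ γ` to `τ` respects both of its inequalities, as all states have trace one, and so does a
positive scaling. -/
theorem exists_densityMatrices_of_witness {a b : ℕ} (ha : 0 < a)
    {ρ γ : Matrix (Fin b) (Fin b) ℂ} (hρ : ρ ∈ densityMatrices b) (hγ : γ ∈ densityMatrices b)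
    {ρ' γ' : Matrix (Fin a) (Fin a) ℂ} (hρ' : ρ' ∈ densityMatrices a)
    (hγ' : γ' ∈ densityMatrices a)
    {τ : Matrix (Fin b) (Fin b) ℂ} {X Y : Matrix (Fin a) (Fin a) ℂ} (hX : X.IsHermitian)
    (hY : Y.IsHermitian) (hle : X ⊗ₖ ρ + Y ⊗ₖ γ ≤ (1 : Matrix (Fin a) (Fin a) ℂ) ⊗ₖ τ)
    (hlt : τ.trace.re < (∑ i, ∑ j, X i j * ρ' i j).re + (∑ i, ∑ j, Y i j * γ' i j).re) :
    ∃ ω₀ ∈ densityMatrices a, ∃ ω₁ ∈ densityMatrices a,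
      ∃ t ∈ minEntropyValues (mixedState ω₀ ω₁ ρ γ),
        t < ((∑ i, ∑ j, ω₀ i j * ρ' i j).re + (∑ i, ∑ j, ω₁ i j * γ' i j).re) / 2 := by
  have ha' : (0 : ℝ) < a := by exact_mod_cast ha
  set K : ℝ := |X.trace.re| / a + |Y.trace.re| / a + ‖X‖ + ‖Y‖ + 1
  have hKpos : 0 < K := by positivity
  set s : ℝ := (K * a)⁻¹ with hs
  have hspos : 0 < s := by positivity
  -- The shift of `Z` by `K - tr Z / a` has trace `K a`, and it is positive because the shift is at
  -- least `‖Z‖`.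
  have key : ∀ Z : Matrix (Fin a) (Fin a) ℂ, Z.IsHermitian → |Z.trace.re| / a + ‖Z‖ ≤ K →
      (s : ℂ) • (Z + ((K - Z.trace.re / a : ℝ) : ℂ) • 1) ∈ densityMatrices a := by
    intro Z hZ hZK
    have him : Z.trace.im = 0 := by
      rw [← Complex.conj_eq_iff_im]
      have := trace_conjTranspose Z
      rw [hZ.eq] at this
      exact this.symm
    have hneg : -(algebraMap ℝ (Matrix (Fin a) (Fin a) ℂ) ‖Z‖) ≤ Z :=
      hZ.isSelfAdjoint.neg_algebraMap_norm_le_self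
    refine ⟨PosSemidef.smul ?_ (by simpa using hspos.le), ?_⟩
    · have h1 := Matrix.le_iff.mp hneg
      have hc : (0 : ℝ) ≤ K - Z.trace.re / a - ‖Z‖ := by
        have := div_le_div_of_nonneg_right (le_abs_self Z.trace.re) ha'.le
        linarith
      have h2 : (((K - Z.trace.re / a - ‖Z‖ : ℝ) : ℂ) •
          (1 : Matrix (Fin a) (Fin a) ℂ)).PosSemidef :=
        PosSemidef.one.smul (by exact_mod_cast hc)
      refine Eq.subst (motive := Matrix.PosSemidef) ?_ (h1.add h2)
      ext i j
      simp [Matrix.algebraMap_matrix_apply, one_apply]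
      split_ifs <;> simp
    · rw [trace_smul, trace_add, trace_smul, trace_one]
      have hre : Z.trace = (Z.trace.re : ℂ) := by apply Complex.ext <;> simp [him]
      rw [hre]
      simp only [smul_eq_mul, Fintype.card_fin, Complex.ofReal_re]
      norm_cast
      rw [hs]
      field_simp
      ring
  have hXa : 0 ≤ |X.trace.re| / a := by positivity
  have hYa : 0 ≤ |Y.trace.re| / a := by positivity
  have h₀ := key X hX (by linarith [norm_nonneg Y])
  have h₁ := key Y hY (by linarith [norm_nonneg X])
  generalize K - X.trace.re / a = c₀ at h₀
  generalize K - Y.trace.re / a = c₁ at h₁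
  have hMle : mixedState ((s : ℂ) • (X + (c₀ : ℂ) • 1)) ((s : ℂ) • (Y + (c₁ : ℂ) • 1)) ρ γ ≤
      (1 : Matrix (Fin a) (Fin a) ℂ) ⊗ₖ ((s / 2 : ℂ) • (τ + (c₀ : ℂ) • ρ + (c₁ : ℂ) • γ)) := by
    rw [Matrix.le_iff] at hle ⊢
    have hs2 : (0 : ℂ) ≤ (s / 2 : ℂ) := by
      have : (0 : ℝ) ≤ s / 2 := by positivity
      exact_mod_cast this
    convert hle.smul hs2 using 1
    ext ⟨i, k⟩ ⟨j, l⟩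
    simp [mixedState]
    ring
  refine ⟨_, h₀, _, h₁, _, ⟨(s / 2 : ℂ) • (τ + (c₀ : ℂ) • ρ + (c₁ : ℂ) • γ), ?_, hMle, rfl⟩, ?_⟩
  · -- `τ` is a diagonal block of `1 ⊗ τ`, which dominates a positive semidefinite matrix.
    have h := ((mixedState_mem h₀ h₁ hρ hγ).1.nonneg.trans hMle).posSemidef.submatrix
      fun k : Fin b => ((⟨0, ha⟩ : Fin a), k)
    refine PosSemidef.nonneg ?_
    convert h using 1
    ext
    simp
    ring
  · have hov : ∀ (Z σ : Matrix (Fin a) (Fin a) ℂ) (c : ℝ), σ ∈ densityMatrices a →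
        (∑ i, ∑ j, ((s : ℂ) • (Z + (c : ℂ) • 1)) i j * σ i j).re =
          s * ((∑ i, ∑ j, Z i j * σ i j).re + c) := by
      intro Z σ c hσ
      have : ∑ i, ∑ j, ((s : ℂ) • (Z + (c : ℂ) • 1)) i j * σ i j =
          s * (∑ i, ∑ j, Z i j * σ i j + c * σ.trace) := by
        simp [trace, one_apply, mul_add, add_mul, Finset.sum_add_distrib, Finset.mul_sum, mul_assoc]
      rw [this, hσ.2, Complex.re_ofReal_mul]
      simp
    rw [hov _ _ _ hρ', hov _ _ _ hγ']
    have htr : ((s / 2 : ℂ) • (τ + (c₀ : ℂ) • ρ + (c₁ : ℂ) • γ)).trace.re =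
        s / 2 * (τ.trace.re + c₀ + c₁) := by
      rw [trace_smul, trace_add, trace_add, trace_smul, trace_smul, hρ.2, hγ.2]
      have : (s / 2 : ℂ) = ((s / 2 : ℝ) : ℂ) := by push_cast; rfl
      rw [this, smul_eq_mul, Complex.re_ofReal_mul]
      simp
    rw [htr]
    nlinarith

/-! ### Gibbs-preserving conversion -/

/-- The quantum channel with Choi matrix `J`. -/
noncomputable def channelOfChoi {d d' : ℕ} (J : Matrix (Fin d' × Fin d) (Fin d' × Fin d) ℂ)
    (hJ : J.PosSemidef) (hJ1 : partialTrace J = 1) : QuantumChannel d d' where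
  toCP := ⟨choiMap J, fun _ _ hM => choiMap_map_nonneg hJ hM⟩
  trace_preserving := trace_choiMap hJ1

theorem mainTheorem2 (d d' : ℕ)
    (γ : Matrix (Fin d) (Fin d) ℂ) (hγ : γ ∈ densityMatrices d)
    (γ' : Matrix (Fin d') (Fin d') ℂ) (hγ' : γ' ∈ densityMatrices d')
    (ρ : Matrix (Fin d) (Fin d) ℂ) (hρ : ρ ∈ densityMatrices d)
    (ρ' : Matrix (Fin d') (Fin d') ℂ) (hρ' : ρ' ∈ densityMatrices d') :
    GibbsConvertible γ γ' ρ ρ' ↔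
      ∀ ω₀ ∈ densityMatrices d', ∀ ω₁ ∈ densityMatrices d',
        condMinEntropy (mixedState ω₀ ω₁ ρ γ) ≤ condMinEntropy (mixedState ω₀ ω₁ ρ' γ') := by
  have hd' := pos_of_mem_densityMatrices hγ'
  constructor
  · rintro ⟨E, rfl, rfl⟩ ω₀ h₀ ω₁ h₁
    have hΩ := mixedState_mem h₀ h₁ hρ hγ
    rw [condMinEntropy_le_iff hd' hΩ (mixedState_mem h₀ h₁ hρ' hγ')]
    exact csInf_le_csInf (bddBelow_minEntropyValues _) (minEntropyValues_nonempty hΩ.1)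
      (minEntropyValues_subset E ω₀ ω₁ ρ γ)
  · intro h
    obtain ⟨J, hJ, hJ1, hJρ, hJγ⟩ | ⟨τ, X, Y, hX, hY, hle, hlt⟩ :=
      exists_choi_or_exists_witness hρ.1.isHermitian hγ.1.isHermitian hρ'.1.isHermitian
        hγ'.1.isHermitian
    · exact ⟨channelOfChoi J hJ hJ1, hJγ, hJρ⟩
    · exfalso
      obtain ⟨ω₀, h₀, ω₁, h₁, t, ht, htlt⟩ :=
        exists_densityMatrices_of_witness hd' hρ hγ hρ' hγ' hX hY hle hlt
      have hΩ' := mixedState_mem h₀ h₁ hρ' hγ'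
      have hmono := (condMinEntropy_le_iff hd' (mixedState_mem h₀ h₁ hρ hγ) hΩ').mp (h ω₀ h₀ ω₁ h₁)
      have hlow := le_csInf (minEntropyValues_nonempty hΩ'.1) fun t ht =>
        overlap_le_of_mem_minEntropyValues ht
      exact absurd ((hlow.trans hmono).trans (csInf_le (bddBelow_minEntropyValues _) ht))
        htlt.not_ge
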